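/- For natural numbers $N$ and $r\ge 1$ let $S_{N,r}$ be the set of tuples $(n_1,\dots,n_r)$ of odd integers $n_i\ge 3$ with $n_1+\cdots+n_r=N$, let $\mathsf{Vect}_{N,r}=\mathbb Q^{S_{N,r}}$ (row vectors), let $\mathbf V_{N,r}\subseteq\mathbb Q[x_1,\dots,x_r]$ be the span of the monomials $x_1^{m_1-1}\cdots x_r^{m_r-1}$ with $(m_1,\dots,m_r)\in S_{N,r}$, and let $\pi:\mathbf V_{N,r}\to\mathsf{Vect}_{N,r}$ be the isomorphism sending a polynomial to its vector of coefficients. For $r\ge 2$ put $$\mathbf W_{N,r}=\{P\in\mathbf V_{N,r} : P(x_1,\dots,x_r)=P(x_2-x_1,x_2,x_3,\dots,x_r)-P(x_2-x_1,x_1,x_3,\dots,x_r)\}.$$ For $f=x_1^d$ and a polynomial $g$ in $r-1$ variables put $$(f\mathbin{\underline\circ}g)(x_1,\dots,x_r)=f(x_1)g(x_2,\dots,x_r)+\sum_{i=1}^{r-1}\Bigl(f(x_{i+1}-x_i)\,g(x_1,\dots,\widehat{x_{i+1}},\dots,x_r)-(-1)^{d}f(x_i-x_{i+1})\,g(x_1,\dots,\widehat{x_i},\dots,x_r)\Bigr),$$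 and let $e\binom{m_1,\dots,m_r}{n_1,\dots,n_r}$ be the coefficient of $x_1^{n_1-1}\cdots x_r^{n_r-1}$ in $x_1^{m_1-1}\mathbin{\underline\circ}(x_1^{m_2-1}\cdots x_{r-1}^{m_r-1})$. Define the following matrices with rows $m$ and columns $n$ in $S_{N,r}$: $$E_{N,r}=\Bigl(e\tbinom{m_1,\dots,m_r}{n_1,\dots,n_r}\Bigr)_{m,n},\qquad E_{N,r}^{(j)}=\Bigl(\delta_{(m_1,\dots,m_{r-j}),(n_1,\dots,n_{r-j})}\;e\tbinom{m_{r-j+1},\dots,m_r}{n_{r-j+1},\dots,n_r}\Bigr)_{m,n}\quad(2\le j\le r),$$ $$F_{N,r}=E_{N,r}-\mathrm{id},\qquad C_{N,r}=E_{N,r}^{(2)}E_{N,r}^{(3)}\cdots E_{N,r}^{(r-1)}E_{N,r}.$$ Tasaka's map is the $\mathbb Q$-linear map $\mathbf W_{N,r}\to\ker{}^tE_{N,r}\subseteq\mathsf{Vect}_{N,r}$, $P\mapsto\pi(P)F_{N,r}$. **Theorem.** Let $N$ be a natural number and assume that Tasaka's map for this $N$ and $r=3$ is injective. Then $\dim_{\mathbb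 Q}\ker C_{N,3}$ (the kernel being the space of right annihilators of $C_{N,3}$) is at least the coefficient of $x^N$ in $2\,\mathbb O(x)\,\mathbb S(x)$, where $$\mathbb O(x)=\frac{x^3}{1-x^2},\qquad \mathbb S(x)=\frac{x^{12}}{(1-x^4)(1-x^6)}.$$ In particular, if Tasaka's map is injective for all $N>0$ and $r\geq 2$, then $\sum_{N>0}\dim_{\mathbb Q}\ker C_{N,3}\,x^N\ge 2\,\mathbb O(x)\mathbb S(x)$ coefficientwise. -/

import Mathlib

namespace OddMZV

noncomputable section

open MvPolynomial

/-- The index set `S_{N,r}`: tuples of `r` odd integers `≥ 3` with sum `N`. -/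
def S (N r : ℕ) : Finset (Fin r → ℕ) :=
  (Finset.Nat.antidiagonalTuple r N).filter fun n => ∀ i, 3 ≤ n i ∧ Odd (n i)

/-- The exponent vector `(n₁ - 1, …, n_r - 1)` of the monomial attached to `(n₁, …, n_r)`
(used for entries `≥ 1` only). -/
def expo {r : ℕ} (n : Fin r → ℕ) : Fin r →₀ ℕ :=
  Finsupp.equivFunOnFinite.symm fun i => n i - 1

/-- `V_{N,r}`: the span of the monomials `x₁^{m₁-1} ⋯ x_r^{m_r-1}`, `m ∈ S_{N,r}`. -/
def V (N r : ℕ) : Submodule ℚ (MvPolynomial (Fin r) ℚ) :=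
  Submodule.span ℚ ((fun m => monomial (expo m) (1 : ℚ)) '' (S N r : Set (Fin r → ℕ)))

/-- The space `Vect_{N,r}` of (row) vectors indexed by `S_{N,r}`. -/
abbrev Vect (N r : ℕ) : Type := S N r → ℚ

/-- The isomorphism `π : V_{N,r} → Vect_{N,r}` reading off the coefficients. -/
def piMap (N r : ℕ) : V N r →ₗ[ℚ] Vect N r :=
  LinearMap.pi fun n => (MvPolynomial.lcoeff ℚ (expo n.1)).comp (V N r).subtype

/-- The substitution `P ↦ P(x₂ - x₁, x₂, x₃, …, x_r)`. -/
def substA {r : ℕ} (hr : 2 ≤ r) : MvPolynomial (Fin r) ℚ →ₐ[ℚ] MvPolynomial (Fin r) ℚ :=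
  aeval fun i => if i = ⟨0, by omega⟩ then X ⟨1, by omega⟩ - X ⟨0, by omega⟩ else X i

/-- The substitution `P ↦ P(x₂ - x₁, x₁, x₃, …, x_r)`. -/
def substB {r : ℕ} (hr : 2 ≤ r) : MvPolynomial (Fin r) ℚ →ₐ[ℚ] MvPolynomial (Fin r) ℚ :=
  aeval fun i =>
    if i = ⟨0, by omega⟩ then X ⟨1, by omega⟩ - X ⟨0, by omega⟩
    else if i = ⟨1, by omega⟩ then X ⟨0, by omega⟩
    else X i

/-- `W_{N,r}`: all `P ∈ V_{N,r}` with
`P(x₁, …, x_r) = P(x₂ - x₁, x₂, x₃, …, x_r) - P(x₂ - x₁, x₁, x₃, …, x_r)`. -/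
def W (N r : ℕ) (hr : 2 ≤ r) : Submodule ℚ (MvPolynomial (Fin r) ℚ) :=
  V N r ⊓ LinearMap.eqLocus LinearMap.id ((substA hr).toLinearMap - (substB hr).toLinearMap)

/-- The Ihara action `f ∘ g` for homogeneous `f` in one variable and `g` in `s` variables; the
result has `s + 1` variables. `Fin.succAbove k` enumerates the variables with the `k`-th one
omitted. -/
def ihara {s : ℕ} (f : Polynomial ℚ) (g : MvPolynomial (Fin s) ℚ) :
    MvPolynomial (Fin (s + 1)) ℚ :=
  Polynomial.aeval (X 0) f * rename Fin.succ g +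
    ∑ i : Fin s,
      (Polynomial.aeval (X i.succ - X i.castSucc) f * rename i.succ.succAbove g -
        (-1) ^ f.natDegree *
          (Polynomial.aeval (X i.castSucc - X i.succ) f * rename i.castSucc.succAbove g))

/-- The number `e(m₁,…,m_r; n₁,…,n_r)`: the coefficient of `x₁^{n₁-1} ⋯ x_r^{n_r-1}` in
`x₁^{m₁-1} ∘ (x₁^{m₂-1} ⋯ x_{r-1}^{m_r-1})`. The value for `r = 0` is never used. -/
def e : {r : ℕ} → (Fin r → ℕ) → (Fin r → ℕ) → ℚ
  | 0, _, _ => 0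
  | _ + 1, m, n =>
      coeff (expo n) (ihara (Polynomial.X ^ (m 0 - 1)) (monomial (expo (Fin.tail m)) 1))

/-- The matrix `E_{N,r}`. -/
def E (N r : ℕ) : Matrix (S N r) (S N r) ℚ :=
  Matrix.of fun m n => e m.1 n.1

/-- The last `j` entries `(m_{r-j+1}, …, m_r)` of `(m₁, …, m_r)`. -/
def lastPart {r : ℕ} (j : ℕ) (hj : j ≤ r) (m : Fin r → ℕ) : Fin j → ℕ :=
  fun i => m ⟨r - j + i, by omega⟩

/-- The matrix `E_{N,r}^{(j)}`: Kronecker delta on the first `r - j` entries, `e` on the last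
`j` entries. -/
def Ej (N r j : ℕ) (hj : j ≤ r) : Matrix (S N r) (S N r) ℚ :=
  Matrix.of fun m n =>
    (if ∀ i : Fin r, (i : ℕ) < r - j → m.1 i = n.1 i then 1 else 0) *
      e (lastPart j hj m.1) (lastPart j hj n.1)

/-- The matrix `C_{N,r} = E_{N,r}^{(2)} ⋯ E_{N,r}^{(r-1)} E_{N,r}`. -/
def C (N r : ℕ) : Matrix (S N r) (S N r) ℚ :=
  (List.ofFn fun i : Fin (r - 2) => Ej N r (i + 2) (by omega)).prod * E N r

/-- The matrix `F_{N,r} = E_{N,r} - id`. -/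
def F (N r : ℕ) : Matrix (S N r) (S N r) ℚ := E N r - 1

/-- Tasaka's map `W_{N,r} → Vect_{N,r}`, `P ↦ π(P) F_{N,r}`. Its image lies in the left kernel of
`E_{N,r}`; whether it is injective does not depend on this choice of codomain. -/
def tasakaMap (N r : ℕ) (hr : 2 ≤ r) : W N r hr →ₗ[ℚ] Vect N r :=
  (F N r).vecMulLinear ∘ₗ piMap N r ∘ₗ Submodule.inclusion inf_le_left

/-- `O(x) = x³ / (1 - x²)`. -/
def seriesO : PowerSeries ℚ := PowerSeries.X ^ 3 * (1 - PowerSeries.X ^ 2)⁻¹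

/-- `S(x) = x¹² / ((1 - x⁴)(1 - x⁶))`. -/
def seriesS : PowerSeries ℚ :=
  PowerSeries.X ^ 12 * ((1 - PowerSeries.X ^ 4) * (1 - PowerSeries.X ^ 6))⁻¹

end

end OddMZV

/-!
Right and left kernels of `C = E⁽²⁾ E` have the same dimension, so the left kernel can be studied:
it contains the left kernel of `E⁽²⁾`, and modulo that it is `range E⁽²⁾ ∩ ker E`. Matrices acting
on row vectors are substitutions acting on polynomials, up to projection to the monomials with
all exponents even and positive. For `P ∈ W`, the defining relation says that `E⁽²⁾` annihilates the
rotated polynomial `P(x₂, x₃, x₁)`, and, as `P` is antisymmetric in `x₁, x₂`, it identifies Tasaka's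
image `π(P) F` with `-π(P) E⁽²⁾`. Applying the relation once more shows that `E` annihilates that
image. Hence `2 dim W ≤ dim ker C` plus the dimension of the kernel of Tasaka's map.

For the lower bound on `dim W`, products of even period polynomials in `x₁, x₂` with even powers of
`x₃` lie in `W`. An antisymmetric even form `p(x, y)` is a period polynomial if its sum over the
rotations `(x, y) ↦ (y, x - y) ↦ (x - y, x)` vanishes. This sum is equivariant up to sign under the
anharmonic group of order six, so it always vanishes at `-1, 0, 1/2, 1, 2`, and imposing a zero
at one point outside these forces six. For degree `2n`, imposing `⌊n/3⌋` zeros is therefore enough,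
and `⌊(n-1)/2⌋ - ⌊n/3⌋` is the coefficient of `xⁿ` in `x⁵ / ((1 - x²)(1 - x³))` for `n > 0`.
-/

namespace OddMZV

noncomputable section

open MvPolynomial

section Polynomials

lemma eval_bind₁ {σ τ R : Type*} [CommSemiring R] (x : τ → R) (f : σ → MvPolynomial τ R)
    (P : MvPolynomial σ R) : eval x (bind₁ f P) = eval (fun i => eval x (f i)) P :=
  eval₂Hom_bind₁ (RingHom.id R) x f P

lemma eval_update_mul_monomial {σ R : Type*} [DecidableEq σ] [CommSemiring R] (x : σ → R) (i : σ)
    (t : R) (d : σ →₀ ℕ) (a : R) :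
    eval (Function.update x i (t * x i)) (monomial d a) = t ^ d i * eval x (monomial d a) := by
  have herase : ((d.erase i).prod fun j k => Function.update x i (t * x i) j ^ k) =
      (d.erase i).prod fun j k => x j ^ k :=
    Finsupp.prod_congr fun j hj => by
      rw [Function.update_of_ne (fun h => by simp [h] at hj)]
  rw [eval_monomial, eval_monomial, ← Finsupp.mul_prod_erase' d i _ (fun _ => pow_zero _),
    ← Finsupp.mul_prod_erase' d i _ (fun _ => pow_zero (x _)), herase, Function.update_self]
  ring

variable {σ K : Type*} [Field K]

/-- The projection of a polynomial to the terms in which the exponent of the `i`-th variable is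
even and positive; `V N r` is cut out by these projections in each degree. -/
def posEvenPart (i : σ) : MvPolynomial σ K →ₗ[K] MvPolynomial σ K :=
  (basisMonomials σ K).constr K fun d => if d i ≠ 0 ∧ Even (d i) then monomial d 1 else 0

lemma posEvenPart_monomial (i : σ) (d : σ →₀ ℕ) (a : K) :
    posEvenPart i (monomial d a) = if d i ≠ 0 ∧ Even (d i) then monomial d a else 0 := by
  have h := (basisMonomials σ K).constr_basis K
    (fun d => if d i ≠ 0 ∧ Even (d i) then monomial d (1 : K) else 0) d
  rw [coe_basisMonomials] at h
  rw [← mul_one a, ← smul_eq_mul, ← smul_monomial, map_smul, posEvenPart, h, smul_ite, smul_zero]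

lemma coeff_posEvenPart (i : σ) (d : σ →₀ ℕ) (P : MvPolynomial σ K) :
    coeff d (posEvenPart i P) = if d i ≠ 0 ∧ Even (d i) then coeff d P else 0 := by
  classical
  induction P using MvPolynomial.induction_on' with
  | monomial u a =>
    rw [posEvenPart_monomial, apply_ite (coeff d), coeff_zero, coeff_monomial]
    split_ifs <;> simp_all
  | add p q hp hq =>
    rw [map_add, coeff_add, coeff_add, hp, hq]
    split_ifs <;> simp only [add_zero]

lemma posEvenPart_idem (i : σ) (P : MvPolynomial σ K) :
    posEvenPart i (posEvenPart i P) = posEvenPart i P := by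
  ext d
  simp only [coeff_posEvenPart]
  split_ifs <;> rfl

lemma posEvenPart_comm (i j : σ) (P : MvPolynomial σ K) :
    posEvenPart i (posEvenPart j P) = posEvenPart j (posEvenPart i P) := by
  ext d
  simp only [coeff_posEvenPart]
  split_ifs <;> rfl

lemma posEvenPart_isHomogeneous {n : ℕ} (i : σ) {P : MvPolynomial σ K} (hP : P.IsHomogeneous n) :
    (posEvenPart i P).IsHomogeneous n := by
  intro d hd
  rw [coeff_posEvenPart] at hd
  exact hP fun h => hd (by rw [h, ite_self])

variable [DecidableEq σ] [NeZero (2 : K)]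

lemma eval_posEvenPart (x : σ → K) (i : σ) (P : MvPolynomial σ K) :
    eval x (posEvenPart i P) = (eval x P + eval (Function.update x i (-x i)) P) / 2 -
      eval (Function.update x i 0) P := by
  induction P using MvPolynomial.induction_on' with
  | monomial d a =>
    have hneg := eval_update_mul_monomial x i (-1) d a
    have hzero := eval_update_mul_monomial x i 0 d a
    rw [neg_one_mul] at hneg
    rw [zero_mul] at hzero
    rw [posEvenPart_monomial, apply_ite (eval x), map_zero, hneg, hzero]
    rcases eq_or_ne (d i) 0 with h0 | h0
    · simp [h0]
    · rcases Nat.even_or_odd (d i) with h | h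
      · simp [h0, h, h.neg_one_pow]
      · simp [h0, Nat.not_even_iff_odd.2 h, h.neg_one_pow]
  | add p q hp hq => rw [map_add, map_add, hp, hq, map_add, map_add, map_add]; ring

variable [Infinite K]

lemma posEvenPart_eq_self_iff {i : σ} {P : MvPolynomial σ K} :
    posEvenPart i P = P ↔ (∀ x, eval (Function.update x i (-x i)) P = eval x P) ∧
      ∀ x, eval (Function.update x i 0) P = 0 := by
  constructor
  · intro h
    refine ⟨fun x => ?_, fun x => ?_⟩ <;> rw [← h] <;>
      simp only [eval_posEvenPart, Function.update_self, Function.update_idem,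
        Function.update_eq_self, neg_neg, neg_zero]
    · rw [add_comm (eval x P)]
    · rw [add_self_div_two, sub_self]
  · rintro ⟨heven, hzero⟩
    refine MvPolynomial.funext fun x => ?_
    rw [eval_posEvenPart, heven, hzero, add_self_div_two, sub_zero]

end Polynomials

section Coefficients

variable {N r : ℕ}

lemma mem_S {n : Fin r → ℕ} : n ∈ S N r ↔ ∑ i, n i = N ∧ ∀ i, 3 ≤ n i ∧ Odd (n i) := by
  simp [S, Finset.Nat.mem_antidiagonalTuple]

@[simp] lemma expo_apply (n : Fin r → ℕ) (i : Fin r) : expo n i = n i - 1 := rfl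

lemma expo_injOn : Set.InjOn expo (S N r : Set (Fin r → ℕ)) := by
  intro m hm n hn h
  ext i
  have hi := DFunLike.congr_fun h i
  have hm3 := ((mem_S.1 hm).2 i).1
  have hn3 := ((mem_S.1 hn).2 i).1
  simp only [expo_apply] at hi
  lia

lemma exists_expo_eq_iff {d : Fin r →₀ ℕ} :
    (∃ m ∈ S N r, expo m = d) ↔ d.degree + r = N ∧ ∀ i, d i ≠ 0 ∧ Even (d i) := by
  constructor
  · rintro ⟨m, hm, rfl⟩
    obtain ⟨hsum, hodd⟩ := mem_S.1 hm
    refine ⟨?_, fun i => ⟨?_, (hodd i).2.tsub_odd odd_one⟩⟩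
    · rw [Finsupp.degree_eq_sum, ← hsum]
      calc ∑ i, expo m i + r = ∑ i, (expo m i + 1) := by simp [Finset.sum_add_distrib]
        _ = ∑ i, m i := Finset.sum_congr rfl fun i _ =>
          Nat.sub_add_cancel (by have := (hodd i).1; lia)
    · have := (hodd i).1
      rw [expo_apply]
      lia
  · rintro ⟨hsum, heven⟩
    refine ⟨fun i => d i + 1, mem_S.2 ⟨?_, fun i => ⟨?_, (heven i).2.add_one⟩⟩, ?_⟩
    · rw [Finset.sum_add_distrib, ← Finsupp.degree_eq_sum, ← hsum]
      simp
    · obtain ⟨hpos, k, hk⟩ := heven i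
      lia
    · ext i
      simp

lemma mem_V_iff_coeff {P : MvPolynomial (Fin r) ℚ} :
    P ∈ V N r ↔ ∀ d, coeff d P ≠ 0 → ∃ m ∈ S N r, expo m = d := by
  have : V N r = restrictSupport ℚ (expo '' (S N r : Set (Fin r → ℕ))) := by
    rw [restrictSupport_eq_span, V, Set.image_image]
  rw [this, mem_restrictSupport_iff]
  simp only [Set.subset_def, Finset.mem_coe, mem_support_iff, Set.mem_image]

lemma posEvenPart_of_mem_V {P : MvPolynomial (Fin r) ℚ} (hP : P ∈ V N r) (i : Fin r) :
    posEvenPart i P = P := by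
  ext d
  rw [coeff_posEvenPart, ite_eq_left_iff]
  intro h
  by_contra hd
  exact h ((exists_expo_eq_iff.1 (mem_V_iff_coeff.1 hP d (Ne.symm hd))).2 i)

lemma isHomogeneous_of_mem_V {P : MvPolynomial (Fin r) ℚ} (hP : P ∈ V N r) :
    P.IsHomogeneous (N - r) := by
  intro d hd
  have hdeg := (exists_expo_eq_iff.1 (mem_V_iff_coeff.1 hP d hd)).1
  exact (DFunLike.congr_fun Finsupp.degree_eq_weight_one d).symm.trans
    (Nat.eq_sub_of_add_eq hdeg)

lemma mem_V_iff {P : MvPolynomial (Fin r) ℚ} :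
    P ∈ V N r ↔ P.IsHomogeneous (N - r) ∧ ∀ i, posEvenPart i P = P := by
  refine ⟨fun hP => ⟨isHomogeneous_of_mem_V hP, posEvenPart_of_mem_V hP⟩, fun ⟨hhom, heven⟩ => ?_⟩
  refine mem_V_iff_coeff.2 fun d hd => exists_expo_eq_iff.2 ?_
  have hd' : ∀ i, d i ≠ 0 ∧ Even (d i) := by
    intro i
    by_contra h
    rw [← heven i, coeff_posEvenPart, if_neg h] at hd
    exact hd rfl
  have hdeg : d.degree = N - r :=
    (DFunLike.congr_fun Finsupp.degree_eq_weight_one d).trans (hhom hd)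
  have hr : r ≤ d.degree := by
    simpa [Finsupp.degree_eq_sum] using
      Finset.card_nsmul_le_sum Finset.univ d 1 fun i _ => Nat.one_le_iff_ne_zero.2 (hd' i).1
  exact ⟨by lia, hd'⟩

lemma rename_mem_V (σ : Equiv.Perm (Fin r)) {P : MvPolynomial (Fin r) ℚ} (hP : P ∈ V N r) :
    rename σ P ∈ V N r := by
  suffices V N r ≤ (V N r).comap (rename σ).toLinearMap from this hP
  refine Submodule.span_le.2 ?_
  rintro _ ⟨m, hm, rfl⟩
  obtain ⟨hsum, hodd⟩ := mem_S.1 hm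
  refine Submodule.subset_span ⟨m ∘ σ.symm, mem_S.2 ⟨?_, fun i => hodd _⟩, ?_⟩
  · exact (Equiv.sum_comp σ.symm m).trans hsum
  · have hexpo : expo (m ∘ σ.symm) = (expo m).mapDomain σ :=
      Finsupp.ext fun i => ((expo m).mapDomain_equiv_apply i).symm
    rw [AlgHom.toLinearMap_apply, rename_monomial, ← hexpo]

instance : FiniteDimensional ℚ (V N r) :=
  FiniteDimensional.span_of_finite ℚ ((S N r).finite_toSet.image _)

instance {hr : 2 ≤ r} : FiniteDimensional ℚ (W N r hr) :=
  Submodule.finiteDimensional_of_le inf_le_left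

variable (N r) in
/-- The extension of `piMap N r` to all polynomials: the vector of the coefficients at the
monomials spanning `V N r`. -/
def coeffVec : MvPolynomial (Fin r) ℚ →ₗ[ℚ] Vect N r :=
  LinearMap.pi fun n => lcoeff ℚ (expo n.1)

lemma coeffVec_apply (P : MvPolynomial (Fin r) ℚ) (n : S N r) :
    coeffVec N r P n = coeff (expo n.1) P := rfl

lemma coeffVec_posEvenPart (i : Fin r) (P : MvPolynomial (Fin r) ℚ) :
    coeffVec N r (posEvenPart i P) = coeffVec N r P := by
  ext n
  rw [coeffVec_apply, coeff_posEvenPart, if_pos ((exists_expo_eq_iff.1 ⟨n.1, n.2, rfl⟩).2 i),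
    coeffVec_apply]

lemma coeffVec_eq_zero_of_posEvenPart_eq_zero {i : Fin r} {P : MvPolynomial (Fin r) ℚ}
    (h : posEvenPart i P = 0) : coeffVec N r P = 0 := by
  rw [← coeffVec_posEvenPart i, h, map_zero]

lemma coeffVec_monomial (m : S N r) :
    coeffVec N r (monomial (expo m.1) 1) = Pi.single m 1 := by
  ext n
  rw [coeffVec_apply, coeff_monomial, Pi.single_apply]
  exact if_congr ⟨fun h => Subtype.ext (expo_injOn n.2 m.2 h.symm), fun h => by rw [h]⟩ rfl rfl

lemma eq_zero_of_coeffVec_eq_zero {P : MvPolynomial (Fin r) ℚ} (hP : P ∈ V N r)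
    (h : coeffVec N r P = 0) : P = 0 := by
  ext d
  by_contra hd
  obtain ⟨m, hm, rfl⟩ := mem_V_iff_coeff.1 hP d hd
  exact hd (congrFun h ⟨m, hm⟩)

lemma vecMul_coeffVec_of_monomial {A : Matrix (S N r) (S N r) ℚ}
    {f : MvPolynomial (Fin r) ℚ →ₗ[ℚ] MvPolynomial (Fin r) ℚ}
    (h : ∀ m n : S N r, A m n = coeff (expo n.1) (f (monomial (expo m.1) 1)))
    {P : MvPolynomial (Fin r) ℚ} (hP : P ∈ V N r) :
    Matrix.vecMul (coeffVec N r P) A = coeffVec N r (f P) := by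
  have heq : Set.EqOn (A.vecMulLinear ∘ₗ coeffVec N r) (coeffVec N r ∘ₗ f)
      ((fun m => monomial (expo m) (1 : ℚ)) '' (S N r : Set (Fin r → ℕ))) := by
    rintro _ ⟨m, hm, rfl⟩
    ext n
    simp only [LinearMap.comp_apply, Matrix.vecMulLinear_apply]
    rw [coeffVec_monomial ⟨m, hm⟩, Matrix.single_one_vecMul]
    exact h ⟨m, hm⟩ n
  exact LinearMap.eqOn_span heq hP

end Coefficients

section IharaOperators

variable {N s : ℕ}

/-- The variables `(x_{i+1} - x_i, x_0, …, x̂_k, …, x_s)`, which the Ihara action substitutes into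
`f(x_0) g(x_1, …, x_s)` for `k = i` and `k = i + 1`. -/
def iharaVars (i : Fin s) (k : Fin (s + 1)) : Fin (s + 1) → MvPolynomial (Fin (s + 1)) ℚ :=
  Fin.cons (X i.succ - X i.castSucc) fun j => X (k.succAbove j)

/-- The linear operator `f(x_0) g(x_1, …, x_s) ↦ f ∘ g` for even `f`, in terms of the polynomial
`f(x_0) g(x_1, …, x_s)`; on `V N (s + 1)` it is right multiplication by `E N (s + 1)`. -/
def iharaOp (s : ℕ) : MvPolynomial (Fin (s + 1)) ℚ →ₗ[ℚ] MvPolynomial (Fin (s + 1)) ℚ :=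
  LinearMap.id + ∑ i : Fin s,
    ((bind₁ (iharaVars i i.succ)).toLinearMap - (bind₁ (iharaVars i i.castSucc)).toLinearMap)

lemma bind₁_iharaVars_X_zero_pow_mul_rename (i : Fin s) (k : Fin (s + 1)) (d : ℕ)
    (g : MvPolynomial (Fin s) ℚ) :
    bind₁ (iharaVars i k) (X 0 ^ d * rename Fin.succ g) =
      (X i.succ - X i.castSucc) ^ d * rename k.succAbove g := by
  have htail : bind₁ (iharaVars i k ∘ Fin.succ) = rename k.succAbove :=
    algHom_ext fun j => by rw [bind₁_X_right, rename_X]; rfl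
  rw [map_mul, map_pow, bind₁_X_right, bind₁_rename, htail]
  rfl

lemma ihara_X_pow_of_even {d : ℕ} (hd : Even d) (g : MvPolynomial (Fin s) ℚ) :
    ihara (Polynomial.X ^ d) g = iharaOp s (X 0 ^ d * rename Fin.succ g) := by
  have hswap (i : Fin s) : (X i.castSucc - X i.succ : MvPolynomial (Fin (s + 1)) ℚ) ^ d =
      (X i.succ - X i.castSucc) ^ d := by rw [← neg_sub, hd.neg_pow]
  simp only [ihara, iharaOp, Polynomial.natDegree_X_pow, hd.neg_one_pow, one_mul, map_pow,
    Polynomial.aeval_X, hswap, LinearMap.add_apply, LinearMap.id_apply, LinearMap.sum_apply,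
    LinearMap.sub_apply, AlgHom.toLinearMap_apply, bind₁_iharaVars_X_zero_pow_mul_rename]

lemma expo_eq_cons (m : Fin (s + 1) → ℕ) : expo m = (expo (Fin.tail m)).cons (m 0 - 1) := by
  ext i
  cases i using Fin.cases <;> rfl

lemma monomial_expo_eq_mul_rename (m : Fin (s + 1) → ℕ) :
    monomial (expo m) (1 : ℚ) =
      X 0 ^ (m 0 - 1) * rename Fin.succ (monomial (expo (Fin.tail m)) 1) := by
  simp only [monomial_eq, C_1, one_mul, Finsupp.prod_fintype _ _ fun _ => pow_zero _, map_prod,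
    map_pow, rename_X, Fin.prod_univ_succ, expo_apply, Fin.tail]

lemma vecMul_E {P : MvPolynomial (Fin (s + 1)) ℚ} (hP : P ∈ V N (s + 1)) :
    Matrix.vecMul (coeffVec N _ P) (E N (s + 1)) = coeffVec N _ (iharaOp s P) := by
  refine vecMul_coeffVec_of_monomial (fun m n => ?_) hP
  rw [monomial_expo_eq_mul_rename,
    ← ihara_X_pow_of_even (((mem_S.1 m.2).2 0).2.tsub_odd odd_one)]
  rfl

/-- The substitution which fixes `x_0` and acts as `w` on the remaining variables. -/
def tailVars (w : Fin s → MvPolynomial (Fin s) ℚ) : Fin (s + 1) → MvPolynomial (Fin (s + 1)) ℚ :=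
  Fin.cons (X 0) fun j => rename Fin.succ (w j)

/-- The operator `iharaOp s` acting on all variables but the first; on `V N (s + 2)` it is right
multiplication by `Ej N (s + 2) (s + 1)`. -/
def iharaTailOp (s : ℕ) : MvPolynomial (Fin (s + 2)) ℚ →ₗ[ℚ] MvPolynomial (Fin (s + 2)) ℚ :=
  LinearMap.id + ∑ i : Fin s, ((bind₁ (tailVars (iharaVars i i.succ))).toLinearMap -
    (bind₁ (tailVars (iharaVars i i.castSucc))).toLinearMap)

lemma bind₁_tailVars_X_zero_pow_mul_rename (w : Fin s → MvPolynomial (Fin s) ℚ) (d : ℕ)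
    (f : MvPolynomial (Fin s) ℚ) :
    bind₁ (tailVars w) (X 0 ^ d * rename Fin.succ f) = X 0 ^ d * rename Fin.succ (bind₁ w f) := by
  rw [map_mul, map_pow, bind₁_X_right, bind₁_rename, rename_bind₁]
  rfl

lemma iharaTailOp_X_zero_pow_mul_rename (d : ℕ) (f : MvPolynomial (Fin (s + 1)) ℚ) :
    iharaTailOp s (X 0 ^ d * rename Fin.succ f) = X 0 ^ d * rename Fin.succ (iharaOp s f) := by
  simp only [iharaTailOp, iharaOp, LinearMap.add_apply, LinearMap.id_apply, LinearMap.sum_apply,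
    LinearMap.sub_apply, AlgHom.toLinearMap_apply, bind₁_tailVars_X_zero_pow_mul_rename, map_add,
    map_sum, map_sub, mul_add, mul_sub, Finset.mul_sum]

lemma eval_bind₁_tailVars (x : Fin (s + 1) → ℚ) (w : Fin s → MvPolynomial (Fin s) ℚ)
    (P : MvPolynomial (Fin (s + 1)) ℚ) :
    eval x (bind₁ (tailVars w) P) = eval (Fin.cons (x 0) fun j => eval (Fin.tail x) (w j)) P := by
  rw [eval_bind₁]
  congr 2
  ext j
  cases j using Fin.cases with
  | zero => exact eval_X _
  | succ j => exact eval_rename _ _ _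

lemma posEvenPart_zero_bind₁_tailVars (w : Fin s → MvPolynomial (Fin s) ℚ)
    (P : MvPolynomial (Fin (s + 1)) ℚ) :
    posEvenPart 0 (bind₁ (tailVars w) P) = bind₁ (tailVars w) (posEvenPart 0 P) :=
  MvPolynomial.funext fun x => by
    simp only [eval_posEvenPart, eval_bind₁_tailVars, Function.update_self, Fin.tail_update_zero,
      Fin.update_cons_zero, Fin.cons_zero]

lemma iharaTailOp_posEvenPart_zero (P : MvPolynomial (Fin (s + 2)) ℚ) :
    posEvenPart 0 (iharaTailOp s P) = iharaTailOp s (posEvenPart 0 P) := by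
  simp only [iharaTailOp, LinearMap.add_apply, LinearMap.id_apply, LinearMap.sum_apply,
    LinearMap.sub_apply, AlgHom.toLinearMap_apply, map_add, map_sum, map_sub,
    posEvenPart_zero_bind₁_tailVars]

lemma iharaTailOp_isHomogeneous {d : ℕ} {P : MvPolynomial (Fin (s + 2)) ℚ}
    (hP : P.IsHomogeneous d) : (iharaTailOp s P).IsHomogeneous d := by
  have hvars (i : Fin s) (k : Fin (s + 1)) (j : Fin (s + 2)) :
      (tailVars (iharaVars i k) j).IsHomogeneous 1 := by
    cases j using Fin.cases with
    | zero => exact isHomogeneous_X _ _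
    | succ j =>
      refine IsHomogeneous.rename_isHomogeneous ?_
      cases j using Fin.cases with
      | zero => exact (isHomogeneous_X _ _).sub (isHomogeneous_X _ _)
      | succ j => exact isHomogeneous_X _ _
  have hbind (i : Fin s) (k : Fin (s + 1)) :
      (bind₁ (tailVars (iharaVars i k)) P).IsHomogeneous d :=
    one_mul d ▸ hP.aeval _ (hvars i k)
  simp only [iharaTailOp, LinearMap.add_apply, LinearMap.id_apply, LinearMap.sum_apply,
    LinearMap.sub_apply, AlgHom.toLinearMap_apply]
  exact hP.add (IsHomogeneous.sum _ _ _ fun i _ => (hbind _ _).sub (hbind _ _))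

lemma coeff_expo_X_zero_pow_mul_rename (d : ℕ) (f : MvPolynomial (Fin s) ℚ)
    (n : Fin (s + 1) → ℕ) :
    coeff (expo n) (X 0 ^ d * rename Fin.succ f) =
      if n 0 - 1 = d then coeff (expo (Fin.tail n)) f else 0 := by
  have hrename : finSuccEquiv ℚ s (rename Fin.succ f) = Polynomial.C f := by
    induction f using MvPolynomial.induction_on with
    | C a => simp [finSuccEquiv_apply]
    | add p q hp hq => simp [hp, hq]
    | mul_X p i hp => simp [hp, finSuccEquiv_X_succ]
  rw [expo_eq_cons, ← finSuccEquiv_coeff_coeff, map_mul, map_pow, finSuccEquiv_X_zero, hrename,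
    Polynomial.coeff_mul_C, Polynomial.coeff_X_pow, ite_mul, one_mul, zero_mul,
    apply_ite (coeff _), coeff_zero]

lemma Ej_apply_of_castSucc (m n : S N (s + 2)) :
    Ej N (s + 2) (s + 1) (Nat.le_succ _) m n =
      if n.1 0 - 1 = m.1 0 - 1 then e (Fin.tail m.1) (Fin.tail n.1) else 0 := by
  have hhead : (∀ i : Fin (s + 2), (i : ℕ) < s + 2 - (s + 1) → m.1 i = n.1 i) ↔
      n.1 0 - 1 = m.1 0 - 1 := by
    have hm := ((mem_S.1 m.2).2 0).1
    have hn := ((mem_S.1 n.2).2 0).1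
    refine ⟨fun h => by rw [h 0 (by simp)], fun h i hi => ?_⟩
    obtain rfl : i = 0 := Fin.ext (by simp at hi ⊢; lia)
    lia
  have htail (k : Fin (s + 2) → ℕ) : lastPart (s + 1) (Nat.le_succ _) k = Fin.tail k := by
    ext i
    exact congrArg k (Fin.ext (by simp; lia))
  simp only [Ej, Matrix.of_apply, hhead, htail, ite_mul, one_mul, zero_mul]

lemma vecMul_Ej {P : MvPolynomial (Fin (s + 2)) ℚ} (hP : P ∈ V N (s + 2)) :
    Matrix.vecMul (coeffVec N _ P) (Ej N (s + 2) (s + 1) (Nat.le_succ _)) =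
      coeffVec N _ (iharaTailOp s P) := by
  refine vecMul_coeffVec_of_monomial (fun m n => ?_) hP
  rw [Ej_apply_of_castSucc, monomial_expo_eq_mul_rename, iharaTailOp_X_zero_pow_mul_rename,
    coeff_expo_X_zero_pow_mul_rename, monomial_expo_eq_mul_rename (Fin.tail m.1),
    Fin.tail, ← ihara_X_pow_of_even (((mem_S.1 m.2).2 _).2.tsub_odd odd_one)]
  rfl

lemma C_three (N : ℕ) : C N 3 = Ej N 3 2 (Nat.le_succ 2) * E N 3 := by
  simp [C]

lemma eval_iharaOp_two (a b c : ℚ) (P : MvPolynomial (Fin 3) ℚ) :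
    eval ![a, b, c] (iharaOp 2 P) = eval ![a, b, c] P +
      (eval ![b - a, a, c] P - eval ![b - a, b, c] P) +
      (eval ![c - b, a, b] P - eval ![c - b, a, c] P) := by
  have hvars (i : Fin 2) (k : Fin 3) : eval ![a, b, c] (bind₁ (iharaVars i k) P) =
      eval ![![a, b, c] i.succ - ![a, b, c] i.castSucc, ![a, b, c] (k.succAbove 0),
        ![a, b, c] (k.succAbove 1)] P := by
    rw [eval_bind₁]
    congr 2
    ext j
    fin_cases j
    · simp [iharaVars]
    · exact eval_X _
    · exact eval_X _
  simp only [iharaOp, LinearMap.add_apply, LinearMap.id_apply, LinearMap.sub_apply,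
    AlgHom.toLinearMap_apply, map_add, map_sub, hvars, Fin.sum_univ_two, add_assoc]
  rfl

lemma eval_iharaTailOp_one (a b c : ℚ) (P : MvPolynomial (Fin 3) ℚ) :
    eval ![a, b, c] (iharaTailOp 1 P) =
      eval ![a, b, c] P + (eval ![a, c - b, b] P - eval ![a, c - b, c] P) := by
  have hvars (k : Fin 2) : eval ![a, b, c] (bind₁ (tailVars (iharaVars 0 k)) P) =
      eval ![a, c - b, ![b, c] (k.succAbove 0)] P := by
    rw [eval_bind₁_tailVars]
    congr 2
    ext j
    fin_cases j
    · rfl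
    · simp [iharaVars]
    · exact eval_X _
  simp only [iharaTailOp, LinearMap.add_apply, LinearMap.id_apply, LinearMap.sub_apply,
    AlgHom.toLinearMap_apply, map_add, map_sub, hvars, Fin.sum_univ_one]
  rfl

end IharaOperators

section DepthThree

variable {N : ℕ} {hr : 2 ≤ 3} {P : MvPolynomial (Fin 3) ℚ}

lemma update_vec_zero {α : Type*} (a b c t : α) :
    Function.update ![a, b, c] 0 t = ![t, b, c] := by
  ext i; fin_cases i <;> rfl

lemma update_vec_one {α : Type*} (a b c t : α) :
    Function.update ![a, b, c] 1 t = ![a, t, c] := by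
  ext i; fin_cases i <;> rfl

lemma update_vec_two {α : Type*} (a b c t : α) :
    Function.update ![a, b, c] 2 t = ![a, b, t] := by
  ext i; fin_cases i <;> rfl

lemma funext_vec {P Q : MvPolynomial (Fin 3) ℚ}
    (h : ∀ a b c, eval ![a, b, c] P = eval ![a, b, c] Q) : P = Q :=
  MvPolynomial.funext fun x => by
    rw [show x = ![x 0, x 1, x 2] from List.ofFn_inj.1 rfl]
    exact h _ _ _

lemma eval_neg_fst (hP : P ∈ V N 3) (a b c : ℚ) :
    eval ![-a, b, c] P = eval ![a, b, c] P := by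
  simpa [update_vec_zero] using
    (posEvenPart_eq_self_iff.1 (posEvenPart_of_mem_V hP 0)).1 ![a, b, c]

lemma eval_neg_snd (hP : P ∈ V N 3) (a b c : ℚ) :
    eval ![a, -b, c] P = eval ![a, b, c] P := by
  simpa [update_vec_one] using
    (posEvenPart_eq_self_iff.1 (posEvenPart_of_mem_V hP 1)).1 ![a, b, c]

lemma eval_neg_trd (hP : P ∈ V N 3) (a b c : ℚ) :
    eval ![a, b, -c] P = eval ![a, b, c] P := by
  simpa [update_vec_two] using
    (posEvenPart_eq_self_iff.1 (posEvenPart_of_mem_V hP 2)).1 ![a, b, c]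

lemma eval_zero_trd (hP : P ∈ V N 3) (a b : ℚ) : eval ![a, b, 0] P = 0 := by
  simpa [update_vec_two] using
    (posEvenPart_eq_self_iff.1 (posEvenPart_of_mem_V hP 2)).2 ![a, b, 0]

lemma mem_W_iff : P ∈ W N 3 hr ↔ P ∈ V N 3 ∧
    ∀ a b c, eval ![a, b, c] P = eval ![b - a, b, c] P - eval ![b - a, a, c] P := by
  have hA (a b c : ℚ) : eval ![a, b, c] (substA hr P) = eval ![b - a, b, c] P := by
    rw [substA, aeval_eq_bind₁, eval_bind₁]
    congr 2
    ext i
    fin_cases i <;> simp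
  have hB (a b c : ℚ) : eval ![a, b, c] (substB hr P) = eval ![b - a, a, c] P := by
    rw [substB, aeval_eq_bind₁, eval_bind₁]
    congr 2
    ext i
    fin_cases i <;> simp
  refine and_congr_right fun _ => ⟨fun h a b c => ?_, fun h => funext_vec fun a b c => ?_⟩
  · rw [← hA, ← hB, ← map_sub]
    exact congrArg _ h
  · exact (h a b c).trans (by simp only [← hA, ← hB, ← map_sub]; rfl)

lemma eval_swap_of_mem_W (hP : P ∈ W N 3 hr) (a b c : ℚ) :
    eval ![b, a, c] P = -eval ![a, b, c] P := by
  obtain ⟨hV, hW⟩ := mem_W_iff.1 hP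
  have ha := eval_neg_fst hV (b - a) a c
  have hb := eval_neg_fst hV (b - a) b c
  rw [neg_sub] at ha hb
  rw [hW a b c, hW b a c, ha, hb]
  ring

lemma iharaOp_of_mem_W (hP : P ∈ W N 3 hr) : iharaOp 2 P = P - iharaTailOp 1 P := by
  refine funext_vec fun a b c => ?_
  rw [eval_iharaOp_two, map_sub, eval_iharaTailOp_one]
  linear_combination (mem_W_iff.1 hP).2 a b c + eval_swap_of_mem_W hP a (c - b) b
    - eval_swap_of_mem_W hP a (c - b) c

/-- A polynomial in `V N 3` with the same image in `Vect N 3` as `P - iharaTailOp 1 P`, which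
is not in `V N 3` in general. -/
def evenTailDiff (P : MvPolynomial (Fin 3) ℚ) : MvPolynomial (Fin 3) ℚ :=
  posEvenPart 2 (posEvenPart 1 (P - iharaTailOp 1 P))

lemma evenTailDiff_mem_V (hP : P ∈ V N 3) : evenTailDiff P ∈ V N 3 := by
  obtain ⟨hhom, heven⟩ := mem_V_iff.1 hP
  refine mem_V_iff.2 ⟨posEvenPart_isHomogeneous _ (posEvenPart_isHomogeneous _
    (hhom.sub (iharaTailOp_isHomogeneous hhom))), fun i => ?_⟩
  fin_cases i
  · rw [Fin.zero_eta, evenTailDiff, posEvenPart_comm 0 2, posEvenPart_comm 0 1,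
      map_sub (posEvenPart 0), iharaTailOp_posEvenPart_zero, heven 0]
  · rw [Fin.mk_one, evenTailDiff, posEvenPart_comm 1 2, posEvenPart_idem]
  · exact posEvenPart_idem _ _

lemma coeffVec_evenTailDiff (P : MvPolynomial (Fin 3) ℚ) :
    coeffVec N 3 (evenTailDiff P) = coeffVec N 3 (P - iharaTailOp 1 P) := by
  rw [evenTailDiff, coeffVec_posEvenPart, coeffVec_posEvenPart]

lemma eval_evenTailDiff (hP : P ∈ V N 3) (a b c : ℚ) :
    eval ![a, b, c] (evenTailDiff P) =
      (eval ![a, c - b, c] P - eval ![a, c - b, b] P +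
        (eval ![a, c + b, c] P - eval ![a, c + b, b] P)) / 2 -
      eval ![a, c, c] P + eval ![a, b, b] P := by
  have hneg₁ : eval ![a, -c - b, c] P = eval ![a, c + b, c] P := by
    rw [← eval_neg_snd hP, neg_sub, sub_neg_eq_add, add_comm]
  have hneg₂ : eval ![a, -c - b, b] P = eval ![a, c + b, b] P := by
    rw [← eval_neg_snd hP, neg_sub, sub_neg_eq_add, add_comm]
  have hneg₃ : eval ![a, -c + b, c] P = eval ![a, c - b, c] P := by
    rw [← eval_neg_snd hP, neg_add, neg_neg, sub_eq_add_neg]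
  have hneg₄ : eval ![a, -c + b, b] P = eval ![a, c - b, b] P := by
    rw [← eval_neg_snd hP, neg_add, neg_neg, sub_eq_add_neg]
  simp only [evenTailDiff, eval_posEvenPart, update_vec_one, update_vec_two, map_sub,
    eval_iharaTailOp_one, Matrix.cons_val, sub_neg_eq_add, sub_zero, zero_sub, zero_add,
    eval_neg_trd hP, eval_zero_trd hP, eval_neg_snd hP, hneg₁, hneg₂, hneg₃, hneg₄]
  ring

lemma posEvenPart_posEvenPart_posEvenPart_eq_zero {f : ℚ → ℚ → ℚ → ℚ} {g h : ℚ → ℚ → ℚ}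
    (hP : ∀ a b c, eval ![a, b, c] P = f a b c - f a (-b) c + g a b + h b c) :
    posEvenPart 0 (posEvenPart 2 (posEvenPart 1 P)) = 0 := by
  refine funext_vec fun a b c => ?_
  simp only [eval_posEvenPart, update_vec_zero, update_vec_one, update_vec_two, Matrix.cons_val,
    hP, map_zero, neg_neg, neg_zero]
  ring

lemma eval_iharaOp_evenTailDiff (hP : P ∈ W N 3 hr) (a b c : ℚ) :
    eval ![a, b, c] (iharaOp 2 (evenTailDiff P) - evenTailDiff P) =
      (eval ![c - b, c + a, a] P - eval ![c - b, c + a, c] P +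
        eval ![c - b, b + a, b] P - eval ![c - b, b + a, a] P) / 2 -
      (eval ![c - -b, c + a, a] P - eval ![c - -b, c + a, c] P +
        eval ![c - -b, -b + a, -b] P - eval ![c - -b, -b + a, a] P) / 2 +
      (eval ![b - a, a, a] P - eval ![b - a, b, b] P) +
      (eval ![c - b, c, c] P - eval ![c - b, b, b] P) := by
  obtain ⟨hV, hW⟩ := mem_W_iff.1 hP
  have hswap := eval_swap_of_mem_W hP
  have hminus (z : ℚ) : eval ![b - a, c - a, z] P =
      eval ![c - b, c - a, z] P - eval ![c - b, b - a, z] P := by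
    simpa only [sub_sub_sub_cancel_right] using hW (b - a) (c - a) z
  have hplus (z : ℚ) : eval ![b - a, c + b, z] P =
      eval ![c + a, c + b, z] P - eval ![c + a, b - a, z] P := by
    simpa only [show c + b - (b - a) = c + a by ring] using hW (b - a) (c + b) z
  have hneg (z : ℚ) : eval ![c + b, -b + a, z] P = eval ![c + b, b - a, z] P := by
    rw [← eval_neg_snd hV, neg_add, neg_neg, sub_eq_add_neg]
  simp only [map_sub, eval_iharaOp_two, eval_evenTailDiff hV, sub_neg_eq_add, eval_neg_trd hV,
    hneg]
  linear_combination (hminus c - hminus a - hswap (b - a) (c - b) c + hswap (b - a) (c - b) b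
    - hplus c + hplus a + hswap (c + a) (b - a) c - hswap (c + a) (b - a) a
    - hswap (c + a) (c + b) c + hswap (c + a) (c + b) a
    + hswap (b - a) (c + b) b - hswap (b - a) (c + b) a) / 2

lemma coeffVec_iharaOp_evenTailDiff (hP : P ∈ W N 3 hr) :
    coeffVec N 3 (iharaOp 2 (evenTailDiff P)) = coeffVec N 3 (evenTailDiff P) := by
  have h := posEvenPart_posEvenPart_posEvenPart_eq_zero
    (f := fun a b c => (eval ![c - b, c + a, a] P - eval ![c - b, c + a, c] P +
      eval ![c - b, b + a, b] P - eval ![c - b, b + a, a] P) / 2)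
    (g := fun a b => eval ![b - a, a, a] P - eval ![b - a, b, b] P)
    (h := fun b c => eval ![c - b, c, c] P - eval ![c - b, b, b] P)
    (eval_iharaOp_evenTailDiff hP)
  rw [← sub_eq_zero, ← map_sub, ← coeffVec_posEvenPart 1, ← coeffVec_posEvenPart 2]
  exact coeffVec_eq_zero_of_posEvenPart_eq_zero h

lemma tasakaMap_apply (P : W N 3 hr) :
    tasakaMap N 3 hr P = coeffVec N 3 (evenTailDiff P.1 - P.1) := by
  change Matrix.vecMul (coeffVec N 3 P.1) (F N 3) = _
  rw [F, Matrix.vecMul_sub, Matrix.vecMul_one, vecMul_E (mem_W_iff.1 P.2).1,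
    iharaOp_of_mem_W P.2, map_sub _ (evenTailDiff _), coeffVec_evenTailDiff]

lemma vecMul_Ej_of_mem_W (P : W N 3 hr) :
    Matrix.vecMul (coeffVec N 3 P.1) (Ej N 3 2 (Nat.le_succ 2)) = -tasakaMap N 3 hr P := by
  rw [vecMul_Ej (mem_W_iff.1 P.2).1, tasakaMap_apply, map_sub, coeffVec_evenTailDiff, map_sub,
    neg_sub, sub_sub_cancel]

lemma tasakaMap_vecMul_E (P : W N 3 hr) : Matrix.vecMul (tasakaMap N 3 hr P) (E N 3) = 0 := by
  have hV := (mem_W_iff.1 P.2).1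
  rw [tasakaMap_apply, vecMul_E (Submodule.sub_mem _ (evenTailDiff_mem_V hV) hV), map_sub, map_sub,
    coeffVec_iharaOp_evenTailDiff P.2, iharaOp_of_mem_W P.2, coeffVec_evenTailDiff, sub_self]

lemma vecMul_Ej_rename_finRotate (P : W N 3 hr) :
    Matrix.vecMul (coeffVec N 3 (rename (finRotate 3) P.1)) (Ej N 3 2 (Nat.le_succ 2)) = 0 := by
  obtain ⟨hV, hW⟩ := mem_W_iff.1 P.2
  have hrot (a b c : ℚ) :
      eval ![a, b, c] (rename (finRotate 3) P.1) = eval ![b, c, a] P.1 := by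
    rw [eval_rename]
    congr 2
    ext i
    fin_cases i <;> rfl
  have hzero : iharaTailOp 1 (rename (finRotate 3) P.1) = 0 := funext_vec fun a b c => by
    rw [eval_iharaTailOp_one, hrot, hrot, hrot, map_zero]
    linear_combination hW b c a
  rw [vecMul_Ej (rename_mem_V _ hV), hzero, map_zero]

end DepthThree

section LinearAlgebra

variable {K : Type*} [Field K]

lemma finrank_ker_mulVecLin {n : Type*} [Fintype n] (A : Matrix n n K) :
    Module.finrank K (LinearMap.ker A.mulVecLin) =
      Module.finrank K (LinearMap.ker A.vecMulLinear) := by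
  have hmul := LinearMap.finrank_range_add_finrank_ker A.mulVecLin
  have hvec := LinearMap.finrank_range_add_finrank_ker A.vecMulLinear
  have hrank := A.rank_transpose
  rw [Matrix.rank, Matrix.rank, Matrix.mulVecLin_transpose] at hrank
  lia

lemma finrank_ker_comp {U V W : Type*} [AddCommGroup U] [Module K U] [FiniteDimensional K U]
    [AddCommGroup V] [Module K V] [AddCommGroup W] [Module K W] (g : V →ₗ[K] W)
    (f : U →ₗ[K] V) :
    Module.finrank K (LinearMap.ker (g ∘ₗ f)) = Module.finrank K (LinearMap.ker f) +
      Module.finrank K (LinearMap.range f ⊓ LinearMap.ker g : Submodule K V) := by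
  have hle : LinearMap.ker f ≤ LinearMap.ker (g ∘ₗ f) := LinearMap.ker_le_ker_comp f g
  have h := LinearMap.finrank_range_add_finrank_ker (f.domRestrict (LinearMap.ker (g ∘ₗ f)))
  rw [LinearMap.range_domRestrict, LinearMap.ker_comp, Submodule.map_comap_eq,
    ← LinearMap.ker_comp, LinearMap.ker_domRestrict,
    (Submodule.comapSubtypeEquivOfLe hle).finrank_eq] at h
  rw [← h, add_comm]

end LinearAlgebra

section TasakaKernel

variable {N : ℕ} (hr : 2 ≤ 3)

lemma finrank_W_le_finrank_ker_Ej : Module.finrank ℚ (W N 3 hr) ≤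
    Module.finrank ℚ (LinearMap.ker (Ej N 3 2 (Nat.le_succ 2)).vecMulLinear) := by
  let rotate : W N 3 hr →ₗ[ℚ] LinearMap.ker (Ej N 3 2 (Nat.le_succ 2)).vecMulLinear :=
    (coeffVec N 3 ∘ₗ (rename (finRotate 3)).toLinearMap ∘ₗ (W N 3 hr).subtype).codRestrict _
      vecMul_Ej_rename_finRotate
  refine LinearMap.finrank_le_finrank_of_injective (f := rotate)
    ((injective_iff_map_eq_zero _).2 fun P hP => Subtype.ext ?_)
  refine rename_injective _ (finRotate 3).injective ?_
  rw [ZeroMemClass.coe_zero, map_zero]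
  exact eq_zero_of_coeffVec_eq_zero (rename_mem_V _ P.2.1) (congrArg Subtype.val hP)

lemma range_tasakaMap_le : LinearMap.range (tasakaMap N 3 hr) ≤
    LinearMap.range (Ej N 3 2 (Nat.le_succ 2)).vecMulLinear ⊓
      LinearMap.ker (E N 3).vecMulLinear := by
  rintro _ ⟨P, rfl⟩
  refine ⟨⟨-coeffVec N 3 P.1, ?_⟩, tasakaMap_vecMul_E P⟩
  rw [map_neg, Matrix.vecMulLinear_apply, vecMul_Ej_of_mem_W, neg_neg]

lemma two_mul_finrank_W_le : 2 * Module.finrank ℚ (W N 3 hr) ≤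
    Module.finrank ℚ (LinearMap.ker (C N 3).mulVecLin) +
      Module.finrank ℚ (LinearMap.ker (tasakaMap N 3 hr)) := by
  have hcomp : (C N 3).vecMulLinear =
      (E N 3).vecMulLinear ∘ₗ (Ej N 3 2 (Nat.le_succ 2)).vecMulLinear := by
    rw [C_three]
    exact LinearMap.ext fun v => (Matrix.vecMul_vecMul v _ _).symm
  rw [finrank_ker_mulVecLin, hcomp, finrank_ker_comp]
  have hW := finrank_W_le_finrank_ker_Ej (N := N) hr
  have hrange := Submodule.finrank_mono (range_tasakaMap_le (N := N) hr)
  have hrank := LinearMap.finrank_range_add_finrank_ker (tasakaMap N 3 hr)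
  linarith

end TasakaKernel

section RotationSums

variable (K : Type*) {R : Type*} [CommRing K] [CommRing R] [Algebra K R] (n : ℕ) (x y : R)

/-- The alternating form `∑ cᵢ (x^{2i+2} y^{2n-2i-2} - x^{2n-2i-2} y^{2i+2})` of degree `2n`,
linear in its coefficient vector `c`. -/
def altForm : (Fin ((n - 1) / 2) → K) →ₗ[K] R :=
  Fintype.linearCombination K fun i =>
    x ^ (2 * (i : ℕ) + 2) * y ^ (2 * (n - i - 1)) - x ^ (2 * (n - i - 1)) * y ^ (2 * (i : ℕ) + 2)

/-- The sum of `altForm` over the rotations `(x, y) ↦ (y, x - y) ↦ (x - y, x)`, where signs are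
dropped because the form is even. -/
def rotSum : (Fin ((n - 1) / 2) → K) →ₗ[K] R :=
  altForm K n x y + altForm K n y (x - y) + altForm K n (x - y) x

variable (c : Fin ((n - 1) / 2) → K)

lemma altForm_apply : altForm K n x y c = ∑ i, c i •
    (x ^ (2 * (i : ℕ) + 2) * y ^ (2 * (n - i - 1)) -
      x ^ (2 * (n - i - 1)) * y ^ (2 * (i : ℕ) + 2)) :=
  Fintype.linearCombination_apply K _ c

lemma rotSum_apply : rotSum K n x y c =
    altForm K n x y c + altForm K n y (x - y) c + altForm K n (x - y) x c :=
  rfl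

lemma map_altForm {A : Type*} [CommRing A] [Algebra K A] (f : R →ₐ[K] A) :
    f (altForm K n x y c) = altForm K n (f x) (f y) c := by
  simp only [altForm_apply, map_sum, map_smul, map_sub, map_mul, map_pow]

lemma map_rotSum {A : Type*} [CommRing A] [Algebra K A] (f : R →ₐ[K] A) :
    f (rotSum K n x y c) = rotSum K n (f x) (f y) c := by
  simp only [rotSum_apply, map_add, map_altForm, map_sub]

lemma altForm_swap : altForm K n y x c = -altForm K n x y c := by
  rw [altForm_apply, altForm_apply, ← Finset.sum_neg_distrib]
  exact Finset.sum_congr rfl fun i _ => by rw [← smul_neg, neg_sub, mul_comm, mul_comm (y ^ _)]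

lemma altForm_self : altForm K n x x c = 0 := by
  rw [altForm_apply]
  exact Finset.sum_eq_zero fun i _ => by rw [mul_comm, sub_self, smul_zero]

lemma altForm_neg_left : altForm K n (-x) y c = altForm K n x y c := by
  rw [altForm_apply, altForm_apply]
  exact Finset.sum_congr rfl fun i _ => by
    rw [Even.neg_pow (by simp [parity_simps]), (even_two_mul _).neg_pow]

lemma altForm_neg_right : altForm K n x (-y) c = altForm K n x y c := by
  rw [altForm_swap, altForm_neg_left, ← altForm_swap]

lemma altForm_zero_left : altForm K n 0 y c = 0 := by
  rw [altForm_apply]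
  refine Finset.sum_eq_zero fun i _ => ?_
  rw [zero_pow (by lia), zero_pow (by lia), zero_mul, zero_mul, sub_zero, smul_zero]

lemma altForm_zero_right : altForm K n x 0 c = 0 := by
  rw [altForm_swap, altForm_zero_left, neg_zero]

lemma altForm_mul (t : R) :
    altForm K n (t * x) (t * y) c = t ^ (2 * n) * altForm K n x y c := by
  rw [altForm_apply, altForm_apply, Finset.mul_sum]
  refine Finset.sum_congr rfl fun i _ => ?_
  have hdeg : 2 * n = (2 * (i : ℕ) + 2) + 2 * (n - i - 1) := by lia
  rw [hdeg, pow_add, mul_smul_comm]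
  congr 1
  ring

lemma rotSum_swap : rotSum K n y x c = -rotSum K n x y c := by
  rw [rotSum_apply, rotSum_apply, ← neg_sub x y, altForm_neg_left, altForm_neg_right,
    altForm_swap K n x y, altForm_swap K n (x - y) x, altForm_swap K n y (x - y)]
  ring

lemma rotSum_sub : rotSum K n x (x - y) c = -rotSum K n x y c := by
  rw [rotSum_apply, rotSum_apply, sub_sub_cancel, altForm_swap K n (x - y) x,
    altForm_swap K n y (x - y), altForm_swap K n x y]
  ring

lemma rotSum_zero_left : rotSum K n 0 y c = 0 := by
  rw [rotSum_apply, zero_sub, altForm_zero_left, altForm_zero_right, altForm_neg_right,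
    altForm_self, add_zero, add_zero]

lemma rotSum_mul (t : R) : rotSum K n (t * x) (t * y) c = t ^ (2 * n) * rotSum K n x y c := by
  rw [rotSum_apply, rotSum_apply, ← mul_sub, altForm_mul, altForm_mul, altForm_mul]
  ring

variable {n} {c}

lemma natDegree_altForm_le {x y : Polynomial K} (hx : x.natDegree ≤ 1) (hy : y.natDegree ≤ 1) :
    (altForm K n x y c).natDegree ≤ 2 * n := by
  have hmul {a b : ℕ} (hab : a + b = 2 * n) : (x ^ a * y ^ b).natDegree ≤ 2 * n :=
    hab ▸ Polynomial.natDegree_mul_le_of_le (by simpa using Polynomial.natDegree_pow_le_of_le a hx)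
      (by simpa using Polynomial.natDegree_pow_le_of_le b hy)
  rw [altForm_apply]
  refine Polynomial.natDegree_sum_le_of_forall_le _ _ fun i _ => ?_
  refine (Polynomial.natDegree_smul_le _ _).trans
    ((Polynomial.natDegree_sub_le _ _).trans (max_le (hmul ?_) (hmul ?_))) <;> lia

lemma natDegree_rotSum_le {x y : Polynomial K} (hx : x.natDegree ≤ 1) (hy : y.natDegree ≤ 1) :
    (rotSum K n x y c).natDegree ≤ 2 * n := by
  have hxy : (x - y).natDegree ≤ 1 := Polynomial.natDegree_sub_le_of_le hx hy
  exact Polynomial.natDegree_add_le_of_degree_le (Polynomial.natDegree_add_le_of_degree_le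
    (natDegree_altForm_le K hx hy) (natDegree_altForm_le K hy hxy)) (natDegree_altForm_le K hxy hx)

end RotationSums

section AnharmonicOrbits

variable {K : Type*} [Field K]

/-- The orbit of `s` under the anharmonic group generated by `t ↦ 1 - t` and `t ↦ t⁻¹`, in
increasing order if `2 < s`. -/
def anharmonicOrbit (s : K) : Fin 6 → K :=
  ![1 - s, (1 - s)⁻¹, s⁻¹, 1 - s⁻¹, (1 - s⁻¹)⁻¹, s]

/-- The rational points other than `∞` with nontrivial stabilizer in the anharmonic group; every
rotation sum vanishes there. -/
def anharmonicFixed (K : Type*) [Field K] : Fin 5 → K := ![-1, 0, 1 / 2, 1, 2]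

lemma anharmonicOrbit_injective (k : Fin 6) :
    Function.Injective fun s : K => anharmonicOrbit s k := by
  intro s t h
  fin_cases k <;> simpa [anharmonicOrbit] using h

variable {n : ℕ} {c : Fin ((n - 1) / 2) → K} {s t : K}

lemma rotSum_one_sub (h : rotSum K n 1 t c = 0) : rotSum K n 1 (1 - t) c = 0 := by
  rw [rotSum_sub, h, neg_zero]

lemma rotSum_one_inv (h : rotSum K n 1 t c = 0) : rotSum K n 1 t⁻¹ c = 0 := by
  obtain rfl | ht := eq_or_ne t 0
  · rwa [inv_zero]
  · have hmul := rotSum_mul K n t⁻¹ 1 c t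
    rw [mul_one, mul_inv_cancel₀ ht, h, rotSum_swap, mul_neg, zero_eq_neg] at hmul
    exact (mul_eq_zero.1 hmul).resolve_left (pow_ne_zero _ ht)

lemma rotSum_anharmonicOrbit (h : rotSum K n 1 s c = 0) (k : Fin 6) :
    rotSum K n 1 (anharmonicOrbit s k) c = 0 := by
  have hinv := rotSum_one_inv h
  have hsub := rotSum_one_sub h
  have hsub_inv := rotSum_one_sub hinv
  fin_cases k
  exacts [hsub, rotSum_one_inv hsub, hinv, hsub_inv, rotSum_one_inv hsub_inv, h]

lemma rotSum_anharmonicFixed [CharZero K] (k : Fin 5) :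
    rotSum K n 1 (anharmonicFixed K k) c = 0 := by
  have hzero : rotSum K n 1 (0 : K) c = 0 := by rw [rotSum_swap, rotSum_zero_left, neg_zero]
  have hone : rotSum K n 1 (1 : K) c = 0 := by simpa using rotSum_one_sub hzero
  have hhalf : rotSum K n 1 (1 / 2 : K) c = 0 :=
    self_eq_neg.1 (by simpa only [sub_half] using rotSum_sub K n (1 : K) (1 / 2) c)
  have htwo : rotSum K n 1 (2 : K) c = 0 := by simpa using rotSum_one_inv hhalf
  have hneg : rotSum K n 1 (-1 : K) c = 0 := by
    rw [show (-1 : K) = 1 - 2 by norm_num]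
    exact rotSum_one_sub htwo
  fin_cases k
  exacts [hneg, hzero, hhalf, hone, htwo]

lemma rotSum_eq_zero [CharZero K] (h : rotSum K n 1 (Polynomial.X : Polynomial K) c = 0)
    (a b : K) : rotSum K n a b c = 0 := by
  have hone (t : K) : rotSum K n 1 t c = 0 := by
    simpa [h, eq_comm] using map_rotSum K n 1 Polynomial.X c (Polynomial.aeval t)
  obtain rfl | ha := eq_or_ne a 0
  · exact rotSum_zero_left K n b c
  · have hmul := rotSum_mul K n 1 (a⁻¹ * b) c a
    rwa [mul_one, mul_inv_cancel_left₀ ha, hone, mul_zero] at hmul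

variable [LinearOrder K] [IsStrictOrderedRing K]

lemma anharmonicFixed_strictMono : StrictMono (anharmonicFixed K) := by
  have hlast : StrictMono ![(2 : K)] := strictMono_vecEmpty
  norm_num [anharmonicFixed, hlast]

lemma anharmonicOrbit_interlaced (hs : 2 < s) (k : Fin 5) :
    anharmonicOrbit s k.castSucc < anharmonicFixed K k ∧
      anharmonicFixed K k < anharmonicOrbit s k.succ := by
  have hinv : 0 < s⁻¹ ∧ s⁻¹ < 1 / 2 :=
    ⟨inv_pos.2 (by linarith), by rw [one_div]; exact inv_strictAnti₀ two_pos hs⟩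
  have hsub_inv : -1 < (1 - s)⁻¹ ∧ (1 - s)⁻¹ < 0 := by
    rw [← neg_sub, inv_neg]
    exact ⟨neg_lt_neg (inv_lt_one_of_one_lt₀ (by linarith)),
      neg_neg_iff_pos.2 (inv_pos.2 (by linarith))⟩
  have hinv_sub_inv : 1 < (1 - s⁻¹)⁻¹ ∧ (1 - s⁻¹)⁻¹ < 2 :=
    ⟨(one_lt_inv₀ (by linarith)).2 (by linarith),
      (inv_lt_comm₀ (by linarith) two_pos).2 (by linarith)⟩
  fin_cases k <;> simp only [anharmonicOrbit, anharmonicFixed, Fin.zero_eta, Fin.mk_one,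
    Fin.reduceFinMk, Fin.castSucc_zero, Fin.castSucc_one, Fin.reduceCastSucc, Fin.succ_zero_eq_one,
    Fin.succ_one_eq_two, Fin.reduceSucc, Matrix.cons_val] <;> constructor <;> linarith

lemma anharmonicOrbit_lt_anharmonicFixed (hs : 2 < s) {k : Fin 6} {l : Fin 5}
    (hkl : k ≤ l.castSucc) : anharmonicOrbit s k < anharmonicFixed K l := by
  obtain ⟨k, rfl⟩ := Fin.exists_castSucc_eq.2 (hkl.trans_lt l.castSucc_lt_last).ne
  exact (anharmonicOrbit_interlaced hs k).1.trans_le (anharmonicFixed_strictMono.monotone hkl)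

lemma anharmonicFixed_lt_anharmonicOrbit (hs : 2 < s) {k : Fin 5} {l : Fin 6}
    (hkl : k.castSucc < l) : anharmonicFixed K k < anharmonicOrbit s l := by
  obtain ⟨l, rfl⟩ := Fin.exists_succ_eq.2 (Fin.ne_zero_of_lt hkl)
  exact (anharmonicFixed_strictMono.monotone (Fin.castSucc_lt_succ_iff.1 hkl)).trans_lt
    (anharmonicOrbit_interlaced hs l).2

lemma anharmonicOrbit_lt (hs : 2 < s) (ht : 2 < t) {k l : Fin 6} (hkl : k < l) :
    anharmonicOrbit s k < anharmonicOrbit t l := by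
  obtain ⟨k, rfl⟩ := Fin.exists_castSucc_eq.2 (Fin.ne_last_of_lt hkl)
  exact (anharmonicOrbit_interlaced hs k).1.trans (anharmonicFixed_lt_anharmonicOrbit ht hkl)

lemma sumElim_anharmonic_injective {ι : Type*} {s : ι → K} (hs : ∀ j, 2 < s j)
    (hinj : Function.Injective s) :
    Function.Injective (Sum.elim (anharmonicFixed K)
      fun p : Fin 6 × ι => anharmonicOrbit (s p.2) p.1) := by
  refine anharmonicFixed_strictMono.injective.sumElim ?_ fun k p => ?_
  · rintro ⟨k, i⟩ ⟨l, j⟩ h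
    obtain hkl | rfl | hlk := lt_trichotomy k l
    · exact absurd h (anharmonicOrbit_lt (hs i) (hs j) hkl).ne
    · exact congrArg _ (hinj (anharmonicOrbit_injective k h))
    · exact absurd h (anharmonicOrbit_lt (hs j) (hs i) hlk).ne'
  · obtain hle | hlt := le_or_gt p.1 k.castSucc
    · exact (anharmonicOrbit_lt_anharmonicFixed (hs p.2) hle).ne'
    · exact (anharmonicFixed_lt_anharmonicOrbit (hs p.2) hlt).ne

end AnharmonicOrbits

section PeriodForms

/-- The coefficient vectors of the even period polynomials of degree `2n` without
`x^{2n} - y^{2n}` term: the forms `altForm` whose rotation sum, dehomogenized here, vanishes. -/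
def periodCoeffs (K : Type*) [CommRing K] (n : ℕ) : Submodule K (Fin ((n - 1) / 2) → K) :=
  LinearMap.ker (rotSum K n 1 (Polynomial.X : Polynomial K))

variable {K : Type*} [Field K] [LinearOrder K] [IsStrictOrderedRing K]

lemma mem_periodCoeffs_of_rotSum_eq_zero {n : ℕ} {c : Fin ((n - 1) / 2) → K}
    (h : ∀ j : Fin (n / 3), rotSum K n 1 ((j : ℕ) + 3 : K) c = 0) : c ∈ periodCoeffs K n := by
  have hinj := sumElim_anharmonic_injective (s := fun j : Fin (n / 3) => ((j : ℕ) + 3 : K))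
    (fun j => by linarith [(j : ℕ).cast_nonneg (α := K)])
    fun i j hij => Fin.ext (Nat.cast_injective (add_right_cancel hij))
  refine Polynomial.eq_zero_of_natDegree_lt_card_of_eval_eq_zero _ hinj ?_ ?_
  · have heval (t : K) : (rotSum K n 1 Polynomial.X c).eval t = rotSum K n 1 t c := by
      simpa using map_rotSum K n 1 Polynomial.X c (Polynomial.aeval t)
    rintro (k | ⟨k, j⟩) <;> rw [heval]
    · exact rotSum_anharmonicFixed k
    · exact rotSum_anharmonicOrbit (h j) k
  · have hdeg : (rotSum K n (1 : Polynomial K) Polynomial.X c).natDegree ≤ 2 * n :=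
      natDegree_rotSum_le K (by simp) Polynomial.natDegree_X_le
    rw [Fintype.card_sum, Fintype.card_prod, Fintype.card_fin, Fintype.card_fin, Fintype.card_fin]
    lia

lemma le_finrank_periodCoeffs (n : ℕ) :
    (n - 1) / 2 - n / 3 ≤ Module.finrank K (periodCoeffs K n) := by
  let f : (Fin ((n - 1) / 2) → K) →ₗ[K] (Fin (n / 3) → K) :=
    LinearMap.pi fun j => rotSum K n 1 ((j : ℕ) + 3 : K)
  have hker : LinearMap.ker f ≤ periodCoeffs K n := fun c hc =>
    mem_periodCoeffs_of_rotSum_eq_zero (congrFun hc)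
  have hrank := LinearMap.finrank_range_add_finrank_ker f
  have hrange := Submodule.finrank_le (LinearMap.range f)
  rw [Module.finrank_fin_fun] at hrank hrange
  have := Submodule.finrank_mono hker
  lia

end PeriodForms

section TernaryPeriodForms

lemma X_pow_mul_eq_monomial_expo {K : Type*} [CommSemiring K] (a b c : ℕ) :
    (X 0 ^ a * X 1 ^ b * X 2 ^ c : MvPolynomial (Fin 3) K) =
      monomial (expo ![a + 1, b + 1, c + 1]) 1 := by
  rw [monomial_eq, Finsupp.prod_fintype _ _ fun _ => pow_zero _, Fin.prod_univ_three, map_one,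
    one_mul]
  rfl

lemma expo_vec_inj {a b c a' b' c' : ℕ} :
    expo ![a + 1, b + 1, c + 1] = expo ![a' + 1, b' + 1, c' + 1] ↔ a = a' ∧ b = b' ∧ c = c' := by
  simp [DFunLike.ext_iff, Fin.forall_fin_succ, expo_apply]

lemma X_pow_mul_mem_V {M a b c : ℕ} (ha : a ≠ 0) (hb : b ≠ 0) (hc : c ≠ 0) (h : a + b + c = M) :
    (X 0 ^ (2 * a) * X 1 ^ (2 * b) * X 2 ^ (2 * c) : MvPolynomial (Fin 3) ℚ) ∈ V (2 * M + 3) 3 := by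
  rw [X_pow_mul_eq_monomial_expo]
  refine Submodule.subset_span ⟨_, mem_S.2 ⟨?_, fun i => ?_⟩, rfl⟩
  · rw [Fin.sum_univ_three]
    simp only [Matrix.cons_val]
    lia
  · fin_cases i <;> exact ⟨by simp; lia, odd_two_mul_add_one _⟩

lemma altForm_mul_X_pow_mem_V {M n a : ℕ} (ha : a ≠ 0) (h : n + a = M)
    (c : Fin ((n - 1) / 2) → ℚ) :
    altForm ℚ n (X 0) (X 1) c * X 2 ^ (2 * a) ∈ V (2 * M + 3) 3 := by
  rw [altForm_apply, Finset.sum_mul]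
  refine Submodule.sum_mem _ fun i _ => ?_
  rw [smul_mul_assoc, sub_mul]
  exact Submodule.smul_mem _ _ (Submodule.sub_mem _
    (X_pow_mul_mem_V (a := i + 1) (by lia) (by lia) ha (by lia))
    (X_pow_mul_mem_V (b := i + 1) (by lia) (by lia) ha (by lia)))

section Coefficients

variable {K : Type*} [CommRing K] {n : ℕ} (c : Fin ((n - 1) / 2) → K)

lemma coeff_altForm_mul_X_pow_of_ne {a b d d' : ℕ} (h : d ≠ d') :
    coeff (expo ![a + 1, b + 1, d' + 1]) (altForm K n (X 0) (X 1) c * X 2 ^ d :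
      MvPolynomial (Fin 3) K) = 0 := by
  rw [altForm_apply, Finset.sum_mul, coeff_sum]
  refine Finset.sum_eq_zero fun i _ => ?_
  simp only [smul_mul_assoc, sub_mul, X_pow_mul_eq_monomial_expo, coeff_smul, coeff_sub,
    coeff_monomial, expo_vec_inj, h, and_false, if_false, sub_self, smul_zero]

lemma coeff_altForm_mul_X_pow (d : ℕ) (i : Fin ((n - 1) / 2)) :
    coeff (expo ![2 * (i : ℕ) + 2 + 1, 2 * (n - i - 1) + 1, d + 1])
      (altForm K n (X 0) (X 1) c * X 2 ^ d : MvPolynomial (Fin 3) K) = c i := by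
  have hterm (j : Fin ((n - 1) / 2)) :
      coeff (expo ![2 * (i : ℕ) + 2 + 1, 2 * (n - i - 1) + 1, d + 1])
        (c j • (X 0 ^ (2 * (j : ℕ) + 2) * X 1 ^ (2 * (n - j - 1)) -
          X 0 ^ (2 * (n - j - 1)) * X 1 ^ (2 * (j : ℕ) + 2)) * X 2 ^ d : MvPolynomial (Fin 3) K) =
      if j = i then c j else 0 := by
    have hfst : (2 * (j : ℕ) + 2 = 2 * i + 2 ∧ 2 * (n - j - 1) = 2 * (n - i - 1)) ↔ j = i := by lia
    have hsnd : ¬(2 * (n - j - 1) = 2 * (i : ℕ) + 2 ∧ 2 * (j : ℕ) + 2 = 2 * (n - i - 1)) := by lia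
    simp only [smul_mul_assoc, sub_mul, X_pow_mul_eq_monomial_expo, coeff_smul, coeff_sub,
      coeff_monomial, expo_vec_inj, and_true, hfst, hsnd, if_false, sub_zero, smul_eq_mul, mul_ite,
      mul_one, mul_zero]
  rw [altForm_apply, Finset.sum_mul, coeff_sum, Finset.sum_congr rfl fun j _ => hterm j]
  exact Fintype.sum_ite_eq' i c

end Coefficients

variable {M : ℕ} (c : (n : Fin M) → periodCoeffs ℚ n)

/-- The ternary form `∑ₙ pₙ(x₁, x₂) x₃^{2(M-n)}` of degree `2M` built from even period
polynomials `pₙ` of degree `2n`. -/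
def periodForm (M : ℕ) :
    ((n : Fin M) → periodCoeffs ℚ n) →ₗ[ℚ] MvPolynomial (Fin 3) ℚ :=
  ∑ n : Fin M, LinearMap.mulRight ℚ (X 2 ^ (2 * (M - n))) ∘ₗ altForm ℚ n (X 0) (X 1) ∘ₗ
    (periodCoeffs ℚ n).subtype ∘ₗ LinearMap.proj n

lemma periodForm_apply : periodForm M c =
    ∑ n : Fin M, altForm ℚ n (X 0) (X 1) (c n).1 * X 2 ^ (2 * (M - n)) := by
  rw [periodForm, LinearMap.sum_apply]
  rfl

lemma eval_periodForm (x y z : ℚ) : eval ![x, y, z] (periodForm M c) =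
    ∑ n : Fin M, altForm ℚ n x y (c n).1 * z ^ (2 * (M - n)) := by
  rw [periodForm_apply, map_sum]
  refine Finset.sum_congr rfl fun n _ => ?_
  rw [map_mul, map_pow, eval_X, ← coe_aeval_eq_eval, RingHom.coe_coe, map_altForm, aeval_X,
    aeval_X]
  rfl

lemma periodForm_mem_V : periodForm M c ∈ V (2 * M + 3) 3 := by
  rw [periodForm_apply]
  exact Submodule.sum_mem _ fun n _ => altForm_mul_X_pow_mem_V (by lia) (by lia) _

lemma periodForm_mem_W (hr : 2 ≤ 3) : periodForm M c ∈ W (2 * M + 3) 3 hr := by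
  refine mem_W_iff.2 ⟨periodForm_mem_V c, fun x y z => ?_⟩
  simp only [eval_periodForm, ← Finset.sum_sub_distrib, ← sub_mul]
  refine Finset.sum_congr rfl fun n _ => congrArg (· * _) ?_
  have hrot := rotSum_eq_zero (c n).2 x y
  rw [rotSum_apply, altForm_swap ℚ n (x - y)] at hrot
  rw [← neg_sub x y, altForm_neg_left, altForm_neg_left]
  linear_combination hrot

lemma coeff_periodForm (n : Fin M) (i : Fin (((n : ℕ) - 1) / 2)) :
    coeff (expo ![2 * (i : ℕ) + 2 + 1, 2 * (n - i - 1) + 1, 2 * (M - n) + 1])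
      (periodForm M c) = (c n).1 i := by
  rw [periodForm_apply, coeff_sum, Finset.sum_eq_single_of_mem n (Finset.mem_univ n)]
  · exact coeff_altForm_mul_X_pow _ _ i
  · exact fun m _ hm => coeff_altForm_mul_X_pow_of_ne _ (by lia)

lemma periodForm_injective (M : ℕ) : Function.Injective (periodForm M) := by
  intro c d h
  ext n i
  rw [← coeff_periodForm, ← coeff_periodForm, h]

lemma sum_le_finrank_W (M : ℕ) (hr : 2 ≤ 3) :
    ∑ n ∈ Finset.range M, ((n - 1) / 2 - n / 3) ≤
      Module.finrank ℚ (W (2 * M + 3) 3 hr) := by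
  have h := LinearMap.finrank_le_finrank_of_injective
    (f := (periodForm M).codRestrict _ fun c => periodForm_mem_W c hr)
    ((periodForm_injective M).codRestrict _)
  rw [Module.finrank_pi_fintype] at h
  rw [← Fin.sum_univ_eq_sum_range fun n => (n - 1) / 2 - n / 3]
  exact (Finset.sum_le_sum fun (n : Fin M) _ => le_finrank_periodCoeffs n.1).trans h

end TernaryPeriodForms

end

section GeneratingSeries

open PowerSeries

lemma mk_sum_range_mul_one_sub_X {A : Type*} [CommRing A] (f : ℕ → A) :
    (mk fun m => ∑ n ∈ Finset.range m, f n) * (1 - X) = mk f * X := by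
  ext (_ | m)
  · simp
  · rw [mul_sub, mul_one, map_sub, coeff_succ_mul_X, coeff_succ_mul_X, coeff_mk, coeff_mk,
      coeff_mk, Finset.sum_range_succ, add_sub_cancel_left]

lemma mk_half_sub_third_mul {A : Type*} [CommRing A] :
    (mk fun n => (((n - 1) / 2 - n / 3 : ℕ) : A)) * ((1 - X ^ 2) * (1 - X ^ 3)) = X ^ 5 := by
  set d : ℕ → ℕ := fun n => (n - 1) / 2 - n / 3 with hd
  have hrec (n : ℕ) : d n + (if 5 ≤ n then d (n - 5) else 0) =
      (if 2 ≤ n then d (n - 2) else 0) + (if 3 ≤ n then d (n - 3) else 0) +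
        if n = 5 then 1 else 0 := by
    simp only [hd]
    lia
  ext n
  have hexpand (p : PowerSeries A) :
      p * ((1 - X ^ 2) * (1 - X ^ 3)) = p - p * X ^ 2 - p * X ^ 3 + p * X ^ 5 := by ring
  have hcast := congrArg (Nat.cast : ℕ → A) (hrec n)
  push_cast at hcast
  simp only [hexpand, map_add, map_sub, coeff_mul_X_pow', coeff_mk, coeff_X_pow]
  linear_combination hcast

lemma seriesO_mul_seriesS : seriesO * seriesS = X ^ 3 *
    expand 2 two_ne_zero
      (mk fun m => ∑ n ∈ Finset.range m, (((n - 1) / 2 - n / 3 : ℕ) : ℚ)) := by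
  set T : PowerSeries ℚ := mk fun m => ∑ n ∈ Finset.range m, (((n - 1) / 2 - n / 3 : ℕ) : ℚ)
  have hT : T * ((1 - X) * ((1 - X ^ 2) * (1 - X ^ 3))) = X ^ 6 := by
    rw [← mul_assoc, mk_sum_range_mul_one_sub_X, mul_right_comm, mk_half_sub_third_mul, ← pow_succ]
  have hexpand := congrArg (expand 2 two_ne_zero) hT
  simp only [map_mul, map_sub, map_one, map_pow, expand_X, ← pow_mul, Nat.reduceMul] at hexpand
  rw [seriesO, seriesS, mul_mul_mul_comm, ← PowerSeries.mul_inv_rev, eq_comm,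
    PowerSeries.eq_mul_inv_iff_mul_eq (by simp), ← hexpand]
  ring

lemma coeff_seriesO_mul_seriesS_le (N : ℕ) (hr : 2 ≤ 3) :
    coeff N (seriesO * seriesS) ≤ Module.finrank ℚ (W N 3 hr) := by
  rw [seriesO_mul_seriesS, coeff_X_pow_mul']
  split_ifs with hN
  · obtain ⟨k, rfl⟩ := Nat.exists_eq_add_of_le' hN
    rw [Nat.add_sub_cancel, coeff_expand]
    split_ifs with hk
    · obtain ⟨M, rfl⟩ := hk
      rw [Nat.mul_div_cancel_left M two_pos, coeff_mk]
      exact_mod_cast sum_le_finrank_W M hr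
    · positivity
  · positivity

end GeneratingSeries

end OddMZV

theorem mainTheorem1_general (N : ℕ) :
    PowerSeries.coeff N (2 * OddMZV.seriesO * OddMZV.seriesS) ≤
      (Module.finrank ℚ (LinearMap.ker (OddMZV.C N 3).mulVecLin) : ℚ) +
        Module.finrank ℚ (LinearMap.ker (OddMZV.tasakaMap N 3 (by norm_num))) := by
  have htwo : (2 : PowerSeries ℚ) = PowerSeries.C 2 := (map_ofNat PowerSeries.C 2).symm
  have hW := OddMZV.coeff_seriesO_mul_seriesS_le N (by norm_num)
  rw [mul_assoc, htwo, PowerSeries.coeff_C_mul]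
  grw [hW]
  exact_mod_cast OddMZV.two_mul_finrank_W_le _

theorem mainTheorem1 (N : ℕ)
    (hinj : Function.Injective (OddMZV.tasakaMap N 3 (by norm_num))) :
    PowerSeries.coeff N (2 * OddMZV.seriesO * OddMZV.seriesS) ≤
      (Module.finrank ℚ (LinearMap.ker (OddMZV.C N 3).mulVecLin) : ℚ) := by
  have h := mainTheorem1_general N
  rwa [LinearMap.ker_eq_bot.2 hinj, finrank_bot, Nat.cast_zero, add_zero] at h
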